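/- Let $\mathcal H$ be a complex Hilbert space. A density operator is a positive bounded operator $\rho$ on $\mathcal H$ with $\operatorname{Tr}\rho=1$, and its von Neumann entropy is $S(\rho)=-\operatorname{Tr}(\rho\log\rho)\in[0,\infty]$, with the convention $0\log 0=0$. Let $(P_n)_n$ be a finite or countably infinite family of orthogonal projections on $\mathcal H$, not necessarily of finite rank, which are mutually orthogonal ($P_mP_n=0$ for $m\neq n$) and complete ($\sum_n P_n=\mathbb 1$ in the strong operator topology), and let $\rho$ be a density operator on $\mathcal H$. Then the series $$\sigma=\sum_n P_n\,\rho\,P_n$$ converges unconditionally in operator norm, $\sigma$ is again a density operator, and $$S(\rho)\le S(\sigma).$$ -/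

import Mathlib

open scoped ENNReal

namespace QuantumEntropy

noncomputable section

/-- A Hilbert (orthonormal) basis of `H`, fixed once and for all. -/
def stdBasis (H : Type*) [NormedAddCommGroup H] [InnerProductSpace ℂ H] [CompleteSpace H] :
    HilbertBasis (exists_hilbertBasis ℂ H).choose ℂ H :=
  (exists_hilbertBasis ℂ H).choose_spec.choose

/-- The trace `Tr T = ∑ᵢ ⟪bᵢ, T bᵢ⟫`, with values in `[0, ∞]`, of a positive bounded operator `T`.
It does not depend on the orthonormal basis, see `posTrace_eq_tsum`. It is used for positive
operators only. -/
def posTrace {H : Type*} [NormedAddCommGroup H] [InnerProductSpace ℂ H] [CompleteSpace H]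
    (T : H →L[ℂ] H) : ℝ≥0∞ :=
  ∑' i, ENNReal.ofReal (inner ℂ (stdBasis H i) (T (stdBasis H i))).re

/-- Parseval's identity with values in `[0, ∞]`. -/
theorem tsum_ofReal_norm_inner_sq {H : Type*} [NormedAddCommGroup H] [InnerProductSpace ℂ H]
    {ι : Type*} (b : HilbertBasis ι ℂ H) (x : H) :
    ∑' i, ENNReal.ofReal (‖inner ℂ (b i) x‖ ^ 2) = ENNReal.ofReal (‖x‖ ^ 2) := by
  have h := b.hasSum_inner_mul_inner x x
  have h2 : HasSum (fun i => ‖inner ℂ (b i) x‖ ^ 2) (‖x‖ ^ 2) := by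
    have h3 := Complex.hasSum_re h
    rw [inner_self_eq_norm_sq_to_K] at h3
    convert h3 using 1
    · funext i
      rw [← inner_conj_symm x (b i), Complex.conj_mul', ← Complex.ofReal_pow, Complex.ofReal_re]
    · simp [← Complex.ofReal_pow]
  rw [← h2.tsum_eq, ENNReal.ofReal_tsum_of_nonneg (fun i => by positivity) h2.summable]

/-- The sum `∑ᵢ ⟪bᵢ, T bᵢ⟫` of a positive operator is the same in all orthonormal bases. -/
theorem tsum_inner_eq_of_isPositive {H : Type*} [NormedAddCommGroup H] [InnerProductSpace ℂ H]
    [CompleteSpace H] {ι κ : Type*} (b : HilbertBasis ι ℂ H) (c : HilbertBasis κ ℂ H)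
    {T : H →L[ℂ] H} (hT : T.IsPositive) :
    ∑' i, ENNReal.ofReal (inner ℂ (b i) (T (b i))).re
      = ∑' j, ENNReal.ofReal (inner ℂ (c j) (T (c j))).re := by
  have hT' : 0 ≤ T := (ContinuousLinearMap.nonneg_iff_isPositive T).2 hT
  obtain ⟨S, hS, hST⟩ : ∃ S : H →L[ℂ] H, IsSelfAdjoint S ∧ S * S = T :=
    ⟨CFC.sqrt T, (CFC.sqrt_nonneg T).isSelfAdjoint, CFC.sqrt_mul_sqrt_self T hT'⟩
  have hsym : ∀ x y, inner ℂ (S x) y = inner ℂ x (S y) := fun x y =>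
    hS.isSymmetric x y
  have hsq : ∀ x, (inner ℂ x (T x)).re = ‖S x‖ ^ 2 := by
    intro x
    rw [← hST, mul_apply_eq_comp, ← hsym, inner_self_eq_norm_sq_to_K]
    simp [← Complex.ofReal_pow]
  simp only [hsq]
  calc ∑' i, ENNReal.ofReal (‖S (b i)‖ ^ 2)
      = ∑' i, ∑' j, ENNReal.ofReal (‖inner ℂ (c j) (S (b i))‖ ^ 2) := by
        simp only [tsum_ofReal_norm_inner_sq]
    _ = ∑' j, ∑' i, ENNReal.ofReal (‖inner ℂ (c j) (S (b i))‖ ^ 2) := ENNReal.tsum_comm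
    _ = ∑' j, ∑' i, ENNReal.ofReal (‖inner ℂ (b i) (S (c j))‖ ^ 2) := by
        refine tsum_congr fun j => tsum_congr fun i => ?_
        rw [← hsym, norm_inner_symm]
    _ = ∑' j, ENNReal.ofReal (‖S (c j)‖ ^ 2) := by
        simp only [tsum_ofReal_norm_inner_sq]

/-- The trace of a positive operator may be computed in any orthonormal basis. -/
theorem posTrace_eq_tsum {H : Type*} [NormedAddCommGroup H] [InnerProductSpace ℂ H]
    [CompleteSpace H] {ι : Type*} (b : HilbertBasis ι ℂ H) {T : H →L[ℂ] H} (hT : T.IsPositive) :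
    posTrace T = ∑' i, ENNReal.ofReal (inner ℂ (b i) (T (b i))).re :=
  tsum_inner_eq_of_isPositive (stdBasis H) b hT

/-- Density (statistical) operators: positive operators of trace one. -/
structure IsDensityOperator {H : Type*} [NormedAddCommGroup H] [InnerProductSpace ℂ H]
    [CompleteSpace H] (ρ : H →L[ℂ] H) : Prop where
  isPositive : ρ.IsPositive
  trace_eq_one : posTrace ρ = 1

/-- The von Neumann entropy `S(ρ) = -Tr (ρ log ρ) = Tr (η(ρ)) ∈ [0, ∞]` of a density operator,
where `η(x) = -x log x`, `η(0) = 0`, and `η(ρ)` is formed with the continuous functional calculus.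
As the spectrum of a density operator lies in `[0, 1]`, where `η ≥ 0`, the operator `η(ρ)` is
positive. -/
def vonNeumannEntropy {H : Type*} [NormedAddCommGroup H] [InnerProductSpace ℂ H]
    [CompleteSpace H] (ρ : H →L[ℂ] H) : ℝ≥0∞ :=
  posTrace (cfc Real.negMulLog ρ)

/-- A complete system of mutually orthogonal (self-adjoint) projections: `∑ₙ Pₙ = 1` in the strong
operator topology. The projections may have finite or infinite rank, or vanish. -/
structure IsCompleteProjectionSystem {H : Type*} [NormedAddCommGroup H] [InnerProductSpace ℂ H]
    [CompleteSpace H] {ι : Type*} (P : ι → H →L[ℂ] H) : Prop where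
  isStarProjection : ∀ n, IsStarProjection (P n)
  orthogonal : ∀ m n, m ≠ n → P m * P n = 0
  hasSum : ∀ x, HasSum (fun n => P n x) x

/-- The state `∑ₙ Pₙ ρ Pₙ` after a Lüders measurement without selection. The series is taken in
the operator norm. -/
def luedersState {H : Type*} [NormedAddCommGroup H] [InnerProductSpace ℂ H] [CompleteSpace H]
    {ι : Type*} (P : ι → H →L[ℂ] H) (ρ : H →L[ℂ] H) : H →L[ℂ] H :=
  ∑' n, P n * ρ * P n

end

end QuantumEntropy

namespace QuantumEntropy

open Filter Topology

universe u

variable {H : Type u} [NormedAddCommGroup H] [InnerProductSpace ℂ H]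

/-! Write η(x) = -x log x and σ for the pinched state. Being positive of finite trace, σ is compact,
so it has an orthonormal eigenbasis f_j with eigenvalues s_j. Pinching preserves traces, so Tr η(ρ)
= ∑_j ∑_n ⟪P_n f_j, η(ρ) P_n f_j⟫. Since ∑_n ‖P_n f_j‖² = 1, Jensen's inequality bounds the inner
sum by η(⟪f_j, σ f_j⟫) = η(s_j) (`tsum_re_inner_cfc_negMulLog_le`), which is at most ⟪f_j, η(σ) f_j⟫
(`negMulLog_le_re_inner_cfc`). Summing over j gives S(ρ) ≤ S(σ). Both estimates come from scalar
bounds on η, a tangent above and a parabola below, carried to operators by monotonicity of the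
functional calculus. No eigenbasis of ρ is needed. -/

theorem re_inner_le_of_le {A B : H →L[ℂ] H} (h : A ≤ B) (x : H) :
    (inner ℂ x (A x)).re ≤ (inner ℂ x (B x)).re := by
  have := ((ContinuousLinearMap.le_def A B).1 h).re_inner_nonneg_right x
  simpa [inner_sub_right] using this

/-- If the coordinates of `A x` are bounded by `cᵢ ‖x‖²`, then `‖A‖² ≤ ∑ᵢ cᵢ`. -/
theorem ofReal_norm_sq_le_tsum {ι : Type*} (b : HilbertBasis ι ℂ H) (A : H →L[ℂ] H)
    (c : ι → ℝ≥0∞)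
    (hc : ∀ i x, ENNReal.ofReal (‖inner ℂ (b i) (A x)‖ ^ 2) ≤ c i * ENNReal.ofReal (‖x‖ ^ 2)) :
    ENNReal.ofReal (‖A‖ ^ 2) ≤ ∑' i, c i := by
  by_cases htop : ∑' i, c i = ∞
  · simp [htop]
  have key : ∀ x, ‖A x‖ ^ 2 ≤ (∑' i, c i).toReal * ‖x‖ ^ 2 := by
    intro x
    have h : ENNReal.ofReal (‖A x‖ ^ 2) ≤ (∑' i, c i) * ENNReal.ofReal (‖x‖ ^ 2) := by
      rw [← tsum_ofReal_norm_inner_sq b (A x), ← ENNReal.tsum_mul_right]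
      exact ENNReal.tsum_le_tsum fun i => hc i x
    rw [← ENNReal.ofReal_toReal htop, ← ENNReal.ofReal_mul ENNReal.toReal_nonneg] at h
    exact (ENNReal.ofReal_le_ofReal_iff (by positivity)).1 h
  have hA : ‖A‖ ≤ Real.sqrt (∑' i, c i).toReal := by
    refine A.opNorm_le_bound (Real.sqrt_nonneg _) fun x => ?_
    refine le_of_sq_le_sq ?_ (by positivity)
    rw [mul_pow, Real.sq_sqrt ENNReal.toReal_nonneg]
    exact key x
  rw [← ENNReal.ofReal_toReal htop]
  refine ENNReal.ofReal_le_ofReal ?_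
  calc ‖A‖ ^ 2 ≤ Real.sqrt (∑' i, c i).toReal ^ 2 := by gcongr
    _ = _ := Real.sq_sqrt ENNReal.toReal_nonneg

theorem ofReal_norm_inner_sq_le (x y : H) :
    ENNReal.ofReal (‖inner ℂ x y‖ ^ 2) ≤ ENNReal.ofReal (‖x‖ ^ 2) * ENNReal.ofReal (‖y‖ ^ 2) := by
  rw [← ENNReal.ofReal_mul (by positivity), ← mul_pow]
  exact ENNReal.ofReal_le_ofReal (by gcongr; exact norm_inner_le_norm x y)

theorem isCompactOperator_rankOne (x y : H) :
    IsCompactOperator (InnerProductSpace.rankOne ℂ x y : H →L[ℂ] H) := by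
  have h : IsCompactOperator (innerSL ℂ y : H →L[ℂ] ℂ) :=
    isCompactOperator_of_locallyCompactSpace_dom (innerSL ℂ y)
  exact h.clm_comp (ContinuousLinearMap.toSpanSingleton ℂ x)

/-! ### Positive operators of finite trace: norm bound, compactness, diagonalisation. -/

variable [CompleteSpace H]

/-- A positive operator is the square of a self-adjoint one. -/
theorem exists_isSelfAdjoint_mul_self {T : H →L[ℂ] H} (hT : T.IsPositive) :
    ∃ S : H →L[ℂ] H, IsSelfAdjoint S ∧ S * S = T :=
  have hT' : 0 ≤ T := (ContinuousLinearMap.nonneg_iff_isPositive T).2 hT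
  ⟨CFC.sqrt T, (CFC.sqrt_nonneg T).isSelfAdjoint, CFC.sqrt_mul_sqrt_self T hT'⟩

theorem inner_apply_eq_of_isSelfAdjoint {S : H →L[ℂ] H} (hS : IsSelfAdjoint S) (x y : H) :
    inner ℂ (S x) y = inner ℂ x (S y) :=
  hS.isSymmetric x y

theorem re_inner_mul_self {S : H →L[ℂ] H} (hS : IsSelfAdjoint S) (x : H) :
    (inner ℂ x ((S * S) x)).re = ‖S x‖ ^ 2 := by
  rw [mul_apply_eq_comp, ← inner_apply_eq_of_isSelfAdjoint hS, inner_self_eq_norm_sq_to_K]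
  simp [← Complex.ofReal_pow]

theorem posTrace_mul_self {ι : Type*} (b : HilbertBasis ι ℂ H) {S : H →L[ℂ] H}
    (hS : IsSelfAdjoint S) (hSS : (S * S).IsPositive) :
    posTrace (S * S) = ∑' i, ENNReal.ofReal (‖S (b i)‖ ^ 2) := by
  simp only [posTrace_eq_tsum b hSS, re_inner_mul_self hS]

/-- The operator norm of a positive operator is at most its trace. -/
theorem ofReal_norm_le_posTrace {T : H →L[ℂ] H} (hT : T.IsPositive) :
    ENNReal.ofReal ‖T‖ ≤ posTrace T := by
  obtain ⟨S, hS, rfl⟩ := exists_isSelfAdjoint_mul_self hT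
  -- By the C*-identity, the claim becomes: operator norm ≤ Hilbert–Schmidt norm for `S`.
  have hn : ‖S * S‖ = ‖S‖ ^ 2 := by
    have := CStarRing.norm_star_mul_self (x := S)
    rw [hS.star_eq] at this
    rw [this, sq]
  rw [hn, posTrace_mul_self (stdBasis H) hS hT]
  refine ofReal_norm_sq_le_tsum (stdBasis H) S _ fun i x => ?_
  rw [← inner_apply_eq_of_isSelfAdjoint hS]
  exact ofReal_norm_inner_sq_le _ _

/-- Positive operators of finite trace are compact. -/
theorem isCompactOperator_of_posTrace_ne_top {T : H →L[ℂ] H} (hT : T.IsPositive)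
    (htr : posTrace T ≠ ∞) : IsCompactOperator T := by
  classical
  obtain ⟨S, hS, rfl⟩ := exists_isSelfAdjoint_mul_self hT
  set b := stdBasis H
  rw [posTrace_mul_self b hS hT] at htr
  -- `R F` is `S` followed by the projection onto the span of the `b i`, `i ∈ F`; the error is
  -- controlled by the tail of the Hilbert–Schmidt sum of `S`.
  set R := fun F : Finset _ => ∑ i ∈ F, InnerProductSpace.rankOne ℂ (b i) (S (b i)) with hR
  have hcoord : ∀ F i x, inner ℂ (b i) ((S - R F) x) = if i ∈ F then 0 else inner ℂ (b i) (S x) := by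
    intro F i x
    have h1 : R F x = ∑ k ∈ F, inner ℂ (S (b k)) x • b k := by simp [hR]
    rw [sub_apply, inner_sub_right, h1, inner_sum]
    simp only [inner_smul_right, orthonormal_iff_ite.1 b.orthonormal i, mul_ite, mul_one, mul_zero,
      Finset.sum_ite_eq, inner_apply_eq_of_isSelfAdjoint hS]
    split_ifs <;> simp
  have hle : ∀ F, ENNReal.ofReal (‖S - R F‖ ^ 2)
      ≤ ∑' i : {i // i ∉ F}, ENNReal.ofReal (‖S (b i)‖ ^ 2) := by
    intro F
    have h := tsum_subtype {i | i ∉ F} fun i => ENNReal.ofReal (‖S (b i)‖ ^ 2)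
    refine (ofReal_norm_sq_le_tsum b (S - R F) _ fun i x => ?_).trans_eq h.symm
    rw [hcoord]
    by_cases hi : i ∈ F
    · simp [hi]
    · rw [if_neg hi, Set.indicator_of_mem (by exact hi), ← inner_apply_eq_of_isSelfAdjoint hS]
      exact ofReal_norm_inner_sq_le _ _
  have h0 : Tendsto (fun F => ENNReal.ofReal (‖S - R F‖ ^ 2)) atTop (𝓝 0) :=
    tendsto_of_tendsto_of_tendsto_of_le_of_le tendsto_const_nhds
      (ENNReal.tendsto_tsum_compl_atTop_zero htr) (fun _ => zero_le) hle
  have hlim : Tendsto R atTop (𝓝 S) := by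
    rw [tendsto_iff_norm_sub_tendsto_zero]
    have h1 := (ENNReal.tendsto_toReal ENNReal.zero_ne_top).comp h0
    have h2 := (Real.continuous_sqrt.tendsto _).comp h1
    simpa [Function.comp_def, ENNReal.toReal_ofReal, Real.sqrt_sq, norm_sub_rev] using h2
  have hRc : ∀ F, IsCompactOperator (R F) := by
    intro F
    induction F using Finset.induction_on with
    | empty => simpa [hR] using isCompactOperator_zero
    | insert a F ha ih =>
      have : R (insert a F) = InnerProductSpace.rankOne ℂ (b a) (S (b a)) + R F := by
        simp [hR, Finset.sum_insert ha]
      rw [this]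
      exact (isCompactOperator_rankOne _ _).add ih
  exact (isCompactOperator_of_tendsto hlim (Eventually.of_forall hRc)).comp_clm S

/-- A compact self-adjoint operator has an orthonormal basis of eigenvectors. -/
theorem exists_hilbertBasis_eigenvectors {T : H →L[ℂ] H} (hT : IsCompactOperator T)
    (hsa : IsSelfAdjoint T) :
    ∃ (κ : Type u) (f : HilbertBasis κ ℂ H), ∀ j, ∃ s : ℂ, T (f j) = s • f j := by
  have hsym : (T : H →ₗ[ℂ] H).IsSymmetric := hsa.isSymmetric
  let E := fun μ => Module.End.eigenspace (T : Module.End ℂ H) μ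
  have hEc : ∀ μ, CompleteSpace (E μ) := by
    intro μ
    have hcl : IsClosed (E μ : Set H) := by
      have : (E μ : Set H) = {x | T x = μ • x} := by
        ext x
        simp [E]
      rw [this]
      exact isClosed_eq T.continuous (continuous_const_smul μ)
    exact hcl.completeSpace_coe
  -- Eigenspaces are mutually orthogonal, so orthonormal bases of each combine into one orthonormal
  -- family.
  have hv := hsym.orthogonalFamily_eigenspaces.orthonormal_sigma_orthonormal
    (v_family := fun μ => (stdBasis (E μ) : _ → E μ)) (fun μ => (stdBasis (E μ)).orthonormal)
  refine ⟨_, HilbertBasis.mkOfOrthogonalEqBot hv ?_, ?_⟩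
  · rw [eq_bot_iff, ← ContinuousLinearMap.orthogonalComplement_iSup_eigenspaces_eq_bot hT hsym,
      ← Submodule.iInf_orthogonal]
    intro x hx
    rw [Submodule.mem_orthogonal] at hx
    simp only [Submodule.mem_iInf]
    intro μ
    rw [Submodule.mem_orthogonal]
    intro u hu
    -- Expanding `u` in the basis of its eigenspace shows that `x` is orthogonal to it.
    have h1 := (stdBasis (E μ)).hasSum_repr ⟨u, hu⟩
    have h2 := h1.mapL ((innerSL ℂ x).comp (E μ).subtypeL)
    have h3 : ∀ i, inner ℂ x (stdBasis (E μ) i : H) = 0 := fun i =>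
      inner_eq_zero_symm.1 (hx _ (Submodule.subset_span ⟨⟨μ, i⟩, rfl⟩))
    have h4 := h2.unique (hasSum_zero.congr_fun fun i => by simp [h3])
    exact inner_eq_zero_symm.1 (by simpa using h4)
  · rintro ⟨μ, i⟩
    refine ⟨μ, ?_⟩
    rw [HilbertBasis.coe_mkOfOrthogonalEqBot]
    exact Module.End.mem_eigenspace_iff.1 (stdBasis (E μ) i).2

/-! ### The pinching `∑ₙ Pₙ T Pₙ`: convergence, positivity, trace. -/

section Pinching

variable {ι : Type*} {P : ι → H →L[ℂ] H}

theorem IsCompleteProjectionSystem.inner_apply (hP : IsCompleteProjectionSystem P) (n : ι)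
    (x y : H) : inner ℂ (P n x) y = inner ℂ x (P n y) :=
  inner_apply_eq_of_isSelfAdjoint (hP.isStarProjection n).isSelfAdjoint x y

theorem IsCompleteProjectionSystem.hasSum_norm_sq (hP : IsCompleteProjectionSystem P) (x : H) :
    HasSum (fun n => ‖P n x‖ ^ 2) (‖x‖ ^ 2) := by
  have h := Complex.hasSum_re ((hP.hasSum x).mapL (innerSL ℂ x))
  convert h using 1
  · funext n
    have h1 := re_inner_mul_self (hP.isStarProjection n).isSelfAdjoint x
    rw [(hP.isStarProjection n).isIdempotentElem.eq] at h1
    simp [h1]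
  · rw [innerSL_apply_apply, inner_self_eq_norm_sq_to_K]
    simp [← Complex.ofReal_pow]

theorem IsCompleteProjectionSystem.tsum_ofReal_norm_sq (hP : IsCompleteProjectionSystem P)
    (x : H) : ∑' n, ENNReal.ofReal (‖P n x‖ ^ 2) = ENNReal.ofReal (‖x‖ ^ 2) := by
  have h := hP.hasSum_norm_sq x
  rw [← h.tsum_eq, ENNReal.ofReal_tsum_of_nonneg (fun i => by positivity) h.summable]

/-- A complete system of projections does not change the trace of a positive operator. -/
theorem IsCompleteProjectionSystem.tsum_tsum_inner (hP : IsCompleteProjectionSystem P)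
    {T : H →L[ℂ] H} (hT : T.IsPositive) {κ : Type*} (b : HilbertBasis κ ℂ H) :
    ∑' j, ∑' n, ENNReal.ofReal (inner ℂ (P n (b j)) (T (P n (b j)))).re = posTrace T := by
  obtain ⟨S, hS, rfl⟩ := exists_isSelfAdjoint_mul_self hT
  rw [posTrace_mul_self b hS hT]
  simp only [re_inner_mul_self hS]
  calc ∑' j, ∑' n, ENNReal.ofReal (‖S (P n (b j))‖ ^ 2)
      = ∑' n, ∑' j, ∑' k, ENNReal.ofReal (‖inner ℂ (b k) (S (P n (b j)))‖ ^ 2) := by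
        rw [ENNReal.tsum_comm]
        simp only [tsum_ofReal_norm_inner_sq]
    -- Self-adjointness moves `S` and `P n` across the inner product, so that Parseval applies in
    -- `j`.
    _ = ∑' n, ∑' k, ∑' j, ENNReal.ofReal (‖inner ℂ (b j) (P n (S (b k)))‖ ^ 2) := by
        refine tsum_congr fun n => ?_
        rw [ENNReal.tsum_comm]
        refine tsum_congr fun k => tsum_congr fun j => ?_
        rw [← inner_apply_eq_of_isSelfAdjoint hS, ← hP.inner_apply, norm_inner_symm]
    _ = ∑' k, ∑' n, ENNReal.ofReal (‖P n (S (b k))‖ ^ 2) := by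
        rw [ENNReal.tsum_comm]
        simp only [tsum_ofReal_norm_inner_sq]
    _ = ∑' k, ENNReal.ofReal (‖S (b k)‖ ^ 2) := by
        simp only [hP.tsum_ofReal_norm_sq]

theorem IsCompleteProjectionSystem.isPositive_conj (hP : IsCompleteProjectionSystem P)
    {T : H →L[ℂ] H} (hT : T.IsPositive) (n : ι) : (P n * T * P n).IsPositive := by
  have h := hT.conj_adjoint (P n)
  rwa [← ContinuousLinearMap.star_eq_adjoint, (hP.isStarProjection n).isSelfAdjoint.star_eq] at h

theorem IsCompleteProjectionSystem.inner_conj (hP : IsCompleteProjectionSystem P)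
    (T : H →L[ℂ] H) (n : ι) (x : H) :
    inner ℂ x ((P n * T * P n) x) = inner ℂ (P n x) (T (P n x)) := by
  rw [hP.inner_apply, mul_apply_eq_comp, mul_apply_eq_comp]

theorem IsCompleteProjectionSystem.tsum_posTrace_conj (hP : IsCompleteProjectionSystem P)
    {T : H →L[ℂ] H} (hT : T.IsPositive) : ∑' n, posTrace (P n * T * P n) = posTrace T := by
  rw [← hP.tsum_tsum_inner hT (stdBasis H), ENNReal.tsum_comm]
  simp only [posTrace, hP.inner_conj]

/-- The series `∑ₙ Pₙ T Pₙ` converges absolutely in operator norm if `T ≥ 0` has finite trace. -/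
theorem IsCompleteProjectionSystem.summable_conj (hP : IsCompleteProjectionSystem P)
    {T : H →L[ℂ] H} (hT : T.IsPositive) (htr : posTrace T ≠ ∞) :
    Summable fun n => P n * T * P n := by
  rw [← hP.tsum_posTrace_conj hT] at htr
  -- Each norm is at most the trace of its term, and these traces add up to that of `T`.
  refine Summable.of_norm_bounded (ENNReal.summable_toReal htr) fun n => ?_
  exact (ENNReal.ofReal_le_iff_le_toReal (ENNReal.ne_top_of_tsum_ne_top htr n)).1
    (ofReal_norm_le_posTrace (hP.isPositive_conj hT n))

theorem IsCompleteProjectionSystem.hasSum_re_inner_luedersState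
    (hP : IsCompleteProjectionSystem P) {T : H →L[ℂ] H} (hT : T.IsPositive)
    (htr : posTrace T ≠ ∞) (x : H) :
    HasSum (fun n => (inner ℂ (P n x) (T (P n x))).re) (inner ℂ x (luedersState P T x)).re := by
  have h := (hP.summable_conj hT htr).hasSum
  have h1 := Complex.hasSum_re
    ((h.mapL (ContinuousLinearMap.apply ℂ H x)).mapL (innerSL ℂ x))
  simp only [ContinuousLinearMap.apply_apply, innerSL_apply_apply, hP.inner_conj] at h1
  exact h1

theorem IsCompleteProjectionSystem.isPositive_luedersState (hP : IsCompleteProjectionSystem P)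
    {T : H →L[ℂ] H} (hT : T.IsPositive) : (luedersState P T).IsPositive := by
  rw [← ContinuousLinearMap.nonneg_iff_isPositive]
  exact tsum_nonneg fun n =>
    (ContinuousLinearMap.nonneg_iff_isPositive _).2 (hP.isPositive_conj hT n)

theorem IsCompleteProjectionSystem.isDensityOperator_luedersState
    (hP : IsCompleteProjectionSystem P) {ρ : H →L[ℂ] H} (hρ : IsDensityOperator ρ) :
    IsDensityOperator (luedersState P ρ) := by
  have htr : posTrace ρ ≠ ∞ := by simp [hρ.trace_eq_one]
  refine ⟨hP.isPositive_luedersState hρ.isPositive, ?_⟩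
  rw [← hρ.trace_eq_one, ← hP.tsum_tsum_inner hρ.isPositive (stdBasis H), posTrace]
  refine tsum_congr fun j => ?_
  have h := hP.hasSum_re_inner_luedersState hρ.isPositive htr (stdBasis H j)
  rw [← h.tsum_eq]
  exact ENNReal.ofReal_tsum_of_nonneg
    (fun n => hρ.isPositive.re_inner_nonneg_right _) h.summable

end Pinching

/-! ### Bounds on `η`, Jensen's inequality and the entropy estimate. -/

section Entropy

open Real ComplexOrder

/-- The tangent of the concave function `-x log x` at `s` lies above its graph. -/
theorem negMulLog_le_tangent {s x : ℝ} (hs : 0 < s) (hx : 0 ≤ x) :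
    negMulLog x ≤ (-log s - 1) * x + s := by
  -- The tangent at 1, rescaled by `s`.
  have h := negMulLog_le_one_sub_self (x := x / s) (by positivity)
  have h1 : negMulLog x = s * negMulLog (x / s) - x * log s := by
    have := negMulLog_mul (x / s) s
    rw [div_mul_cancel₀ _ hs.ne'] at this
    rw [this, negMulLog_def]
    field_simp
    ring
  have h2 : s * negMulLog (x / s) ≤ s * (1 - x / s) := by gcongr
  have h3 : s * (1 - x / s) = s - x := by field_simp
  linarith

/-- A parabola touching the graph of `-x log x` at `s` from below. -/
theorem parabola_le_negMulLog {s x : ℝ} (hs : 0 < s) (hx : 0 ≤ x) :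
    (1 - log s) * x + -s⁻¹ * x ^ 2 ≤ negMulLog x := by
  rcases hx.eq_or_lt with rfl | hx
  · simp
  have h := mul_le_mul_of_nonneg_left (log_le_sub_one_of_pos (div_pos hx hs)) hx.le
  rw [log_div hx.ne' hs.ne'] at h
  have h1 : x * (x / s - 1) = s⁻¹ * x ^ 2 - x := by field_simp
  rw [negMulLog_def]
  linarith

variable {ρ : H →L[ℂ] H}

theorem nonneg_of_mem_spectrum (hρ : ρ.IsPositive) {x : ℝ} (hx : x ∈ spectrum ℝ ρ) : 0 ≤ x :=
  spectrum_nonneg_of_nonneg ((ContinuousLinearMap.nonneg_iff_isPositive ρ).2 hρ) hx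

theorem IsDensityOperator.norm_le_one (hρ : IsDensityOperator ρ) : ‖ρ‖ ≤ 1 := by
  have h := ofReal_norm_le_posTrace hρ.isPositive
  rwa [hρ.trace_eq_one, ENNReal.ofReal_le_one] at h

theorem IsDensityOperator.isPositive_cfc_negMulLog (hρ : IsDensityOperator ρ) :
    (cfc negMulLog ρ).IsPositive := by
  rw [← ContinuousLinearMap.nonneg_iff_isPositive]
  refine cfc_nonneg fun x hx => negMulLog_nonneg (nonneg_of_mem_spectrum hρ.isPositive hx) ?_
  have h : ‖x‖ ≤ ‖ρ‖ * ‖(1 : H →L[ℂ] H)‖ := spectrum.norm_le_norm_mul_of_mem hx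
  calc x ≤ ‖x‖ := le_norm_self x
    _ ≤ ‖ρ‖ * ‖(1 : H →L[ℂ] H)‖ := h
    _ ≤ 1 * 1 := by
      gcongr
      · exact hρ.norm_le_one
      · exact ContinuousLinearMap.norm_id_le
    _ = 1 := one_mul 1

theorem cfc_negMulLog_le (hρ : ρ.IsPositive) {s : ℝ} (hs : 0 < s) :
    cfc negMulLog ρ ≤ (-log s - 1) • ρ + s • (1 : H →L[ℂ] H) := by
  have hsa := hρ.isSelfAdjoint
  have h : cfc (fun x => (-log s - 1) * x + s) ρ = (-log s - 1) • ρ + s • (1 : H →L[ℂ] H) := by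
    rw [cfc_add .., cfc_const_mul_id .., cfc_const .., Algebra.algebraMap_eq_smul_one]
  rw [← h]
  exact cfc_mono fun x hx => negMulLog_le_tangent hs (nonneg_of_mem_spectrum hρ hx)

theorem le_cfc_negMulLog (hρ : ρ.IsPositive) {s : ℝ} (hs : 0 < s) :
    (1 - log s) • ρ + -s⁻¹ • ρ ^ 2 ≤ cfc negMulLog ρ := by
  have hsa := hρ.isSelfAdjoint
  have h : cfc (fun x => (1 - log s) * x + -s⁻¹ * x ^ 2) ρ = (1 - log s) • ρ + -s⁻¹ • ρ ^ 2 := by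
    rw [cfc_add .., cfc_const_mul_id .., cfc_const_mul .., cfc_pow_id ..]
  rw [← h]
  exact cfc_mono fun x hx => parabola_le_negMulLog hs (nonneg_of_mem_spectrum hρ hx)

theorem re_inner_cfc_negMulLog_le (hρ : ρ.IsPositive) {s : ℝ} (hs : 0 < s) (x : H) :
    (inner ℂ x (cfc negMulLog ρ x)).re
      ≤ (-log s - 1) * (inner ℂ x (ρ x)).re + s * ‖x‖ ^ 2 := by
  refine (re_inner_le_of_le (cfc_negMulLog_le hρ hs) x).trans_eq ?_
  simp [inner_smul_right_eq_smul, inner_self_eq_norm_sq_to_K,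
    ← Complex.ofReal_pow]

/-- The parabola involves only `ρ` and `ρ ^ 2`, which act on an eigenvector by `s` and `s ^ 2`, and
it touches `η` at `s`. At `s = 0` there is no such parabola, but positivity suffices. -/
theorem negMulLog_le_re_inner_cfc (hρ : IsDensityOperator ρ) {s : ℝ} (hs : 0 ≤ s) {x : H}
    (hx : ‖x‖ = 1) (hxs : ρ x = (s : ℂ) • x) :
    negMulLog s ≤ (inner ℂ x (cfc negMulLog ρ x)).re := by
  rcases hs.eq_or_lt with rfl | hs
  · simpa using hρ.isPositive_cfc_negMulLog.re_inner_nonneg_right x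
  have h := re_inner_le_of_le (le_cfc_negMulLog hρ.isPositive hs) x
  refine le_of_eq_of_le ?_ h
  have h2 : (ρ ^ 2) x = ((s ^ 2 : ℝ) : ℂ) • x := by
    rw [sq, mul_apply_eq_comp, hxs, map_smul, hxs, smul_smul, sq, Complex.ofReal_mul]
  have h3 : ((1 - log s) • ρ + -s⁻¹ • ρ ^ 2) x = ((-log s * s : ℝ) : ℂ) • x := by
    rw [add_apply, smul_apply, smul_apply, h2, hxs, ← Complex.coe_smul, ← Complex.coe_smul,
      smul_smul, smul_smul, ← add_smul]
    congr 1
    norm_cast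
    field_simp
    ring
  rw [h3, inner_smul_right, inner_self_eq_norm_sq_to_K, hx, negMulLog_def]
  simp [mul_comm]

variable {ι : Type*} {P : ι → H →L[ℂ] H}

/-- Jensen's inequality for the state of a unit vector after a measurement without selection. -/
theorem tsum_re_inner_cfc_negMulLog_le (hP : IsCompleteProjectionSystem P)
    (hρ : IsDensityOperator ρ) {x : H} (hx : ‖x‖ = 1) :
    ∑' n, ENNReal.ofReal (inner ℂ (P n x) (cfc negMulLog ρ (P n x))).re
      ≤ ENNReal.ofReal (negMulLog (inner ℂ x (luedersState P ρ x)).re) := by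
  have htr : posTrace ρ ≠ ∞ := by simp [hρ.trace_eq_one]
  set t := (inner ℂ x (luedersState P ρ x)).re with ht
  have ht0 : 0 ≤ t := (hP.isPositive_luedersState hρ.isPositive).re_inner_nonneg_right x
  have h0 : ∀ n, 0 ≤ (inner ℂ (P n x) (cfc negMulLog ρ (P n x))).re := fun n =>
    hρ.isPositive_cfc_negMulLog.re_inner_nonneg_right _
  -- The tangent bound at every `s > 0`; the choice `s = t` yields `η(t)`. For `t = 0` there is no
  -- tangent, and `s → 0` is used instead.
  have hbound : ∀ s : ℝ, 0 < s →
      ∑' n, ENNReal.ofReal (inner ℂ (P n x) (cfc negMulLog ρ (P n x))).re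
        ≤ ENNReal.ofReal ((-log s - 1) * t + s) := by
    intro s hs
    have hsum : HasSum (fun n => (-log s - 1) * (inner ℂ (P n x) (ρ (P n x))).re
        + s * ‖P n x‖ ^ 2) ((-log s - 1) * t + s) := by
      have h1 := (hP.hasSum_re_inner_luedersState hρ.isPositive htr x).mul_left (-log s - 1)
      have h2 := (hP.hasSum_norm_sq x).mul_left s
      rw [hx, one_pow, mul_one] at h2
      exact h1.add h2
    have hle := fun n => re_inner_cfc_negMulLog_le hρ.isPositive hs (P n x)
    rw [← hsum.tsum_eq, ENNReal.ofReal_tsum_of_nonneg (fun n => (h0 n).trans (hle n)) hsum.summable]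
    exact ENNReal.tsum_le_tsum fun n => ENNReal.ofReal_le_ofReal (hle n)
  rcases ht0.eq_or_lt with h | h
  · rw [← h, negMulLog_zero]
    refine ge_of_tendsto (f := fun s : ℝ => ENNReal.ofReal s) (x := 𝓝[>] 0)
      ((ENNReal.continuous_ofReal.tendsto 0).mono_left nhdsWithin_le_nhds) ?_
    filter_upwards [self_mem_nhdsWithin] with s hs
    simpa [← h] using hbound s hs
  · refine (hbound t h).trans_eq ?_
    rw [negMulLog_def]
    ring_nf

/-- A measurement without selection does not decrease the von Neumann entropy. -/
theorem vonNeumannEntropy_le_luedersState (hP : IsCompleteProjectionSystem P)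
    (hρ : IsDensityOperator ρ) :
    vonNeumannEntropy ρ ≤ vonNeumannEntropy (luedersState P ρ) := by
  have hσ := hP.isDensityOperator_luedersState hρ
  obtain ⟨κ, f, hf⟩ := exists_hilbertBasis_eigenvectors
    (isCompactOperator_of_posTrace_ne_top hσ.isPositive (by simp [hσ.trace_eq_one]))
    hσ.isPositive.isSelfAdjoint
  -- Both traces are computed in the eigenbasis of σ and compared term by term.
  rw [vonNeumannEntropy, vonNeumannEntropy, ← hP.tsum_tsum_inner hρ.isPositive_cfc_negMulLog f,
    posTrace_eq_tsum f hσ.isPositive_cfc_negMulLog]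
  refine ENNReal.tsum_le_tsum fun j => ?_
  have hfj : ‖f j‖ = 1 := f.orthonormal.1 j
  refine (tsum_re_inner_cfc_negMulLog_le hP hρ hfj).trans (ENNReal.ofReal_le_ofReal ?_)
  obtain ⟨s, hs⟩ := hf j
  have h1 : inner ℂ (f j) (luedersState P ρ (f j)) = s := by
    rw [hs, inner_smul_right, inner_self_eq_norm_sq_to_K, hfj]
    simp
  have h2 : 0 ≤ s := h1 ▸ hσ.isPositive.inner_nonneg_right (f j)
  have h3 : ((s.re : ℝ) : ℂ) = s := Complex.ext rfl (Complex.nonneg_iff.1 h2).2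
  rw [h1]
  exact negMulLog_le_re_inner_cfc hσ (Complex.nonneg_iff.1 h2).1 hfj (by rw [h3, hs])

end Entropy

end QuantumEntropy

theorem proposition6 {H : Type*} [NormedAddCommGroup H] [InnerProductSpace ℂ H] [CompleteSpace H]
    {ι : Type*} [Countable ι] (P : ι → H →L[ℂ] H)
    (hP : QuantumEntropy.IsCompleteProjectionSystem P)
    (ρ : H →L[ℂ] H) (hρ : QuantumEntropy.IsDensityOperator ρ) :
    Summable (fun n => P n * ρ * P n) ∧
      QuantumEntropy.IsDensityOperator (QuantumEntropy.luedersState P ρ) ∧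
      QuantumEntropy.vonNeumannEntropy ρ
        ≤ QuantumEntropy.vonNeumannEntropy (QuantumEntropy.luedersState P ρ) :=
  ⟨hP.summable_conj hρ.isPositive (by simp [hρ.trace_eq_one]),
    hP.isDensityOperator_luedersState hρ,
    QuantumEntropy.vonNeumannEntropy_le_luedersState hP hρ⟩
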